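/- Let $\mathcal G=(\mathcal V,\mathcal E)$ be a connected bipartite graph with $P=|\mathcal V|\ge 2$ nodes and colour classes $\mathcal C_1,\mathcal C_2$ (every edge joins a node of $\mathcal C_1$ to a node of $\mathcal C_2$); write $\mathcal N_p$ for the set of neighbours of node $p$ and $D_p=|\mathcal N_p|$. Let $m<n$, let $A\in\mathbb R^{m\times n}$ have full rank $m$, let $b\in\mathbb R^m$, and let the rows of $A$ and the corresponding entries of $b$ be partitioned among the nodes, $A_p$ and $b_p$ denoting the rows and entries held by node $p$. Basis Pursuit (BP) is the problem of minimizing $\|x\|_1$ over $x\in\mathbb R^n$ subject to $Ax=b$. Fix $\rho>0$. The algorithm D-ADMM starts from $x_p^{(1)}=\gamma_p^{(1)}=0$ for all $p\in\mathcal V$, and for $k=1,2,\dots$ it performs the following steps. 1. For all $p\in\mathcal C_1$, set $v_p^{(k)}=\gamma_p^{(k)}-\rho\sum_{j\in\mathcal N_p}x_j^{(k)}$ and $$x_p^{(k+1)}=\operatorname*{argmin}_{x_p\in\mathbb R^n:\;A_px_p=b_p}\ \tfrac1P\|x_p\|_1+{v_p^{(k)}}^{\top}x_p+\tfrac{D_p\rho}{2}\|x_p\|_2^2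 .$$ 2. For all $p\in\mathcal C_2$, do the same with $v_p^{(k)}=\gamma_p^{(k)}-\rho\sum_{j\in\mathcal N_p}x_j^{(k+1)}$. 3. For all $p\in\mathcal V$, set $\gamma_p^{(k+1)}=\gamma_p^{(k)}+\rho\sum_{j\in\mathcal N_p}\bigl(x_p^{(k+1)}-x_j^{(k+1)}\bigr)$. Then these sequences are well defined (each argmin exists and is unique), and there is a solution $x^\star$ of BP such that $x_p^{(k)}\to x^\star$ as $k\to\infty$ for every node $p$. -/

import Mathlib

open Filter Topology
open scoped Matrix

/-- Column vectors of length `n`, with the Euclidean norm and inner product. -/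
abbrev Vec (n : ℕ) : Type := EuclideanSpace ℝ (Fin n)

/-- The `ℓ₁` norm `|x₁| + ⋯ + |xₙ|`. -/
def l1Norm {n : ℕ} (x : Vec n) : ℝ := ∑ i, |x i|

/-- `x` is a minimizer of `f` over the set `S`. -/
def IsArgmin {E : Type*} (f : E → ℝ) (S : Set E) (x : E) : Prop :=
  x ∈ S ∧ ∀ y ∈ S, f x ≤ f y

/-- The solution set of the linear system `A x = b`. -/
def linearSolutions {ι : Type*} {n : ℕ} (A : Matrix ι (Fin n) ℝ) (b : ι → ℝ) : Set (Vec n) :=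
  {x | A *ᵥ x.ofLp = b}

/-- `x` is a solution of Basis Pursuit: minimize `‖x‖₁` subject to `A x = b`. -/
def IsBPSolution {m n : ℕ} (A : Matrix (Fin m) (Fin n) ℝ) (b : Fin m → ℝ) (x : Vec n) : Prop :=
  IsArgmin l1Norm (linearSolutions A b) x

/-- The block `A_p`: the rows of `A` held by node `p`, where row `i` is held by `owner i`. -/
def rowBlock {V : Type*} {m n : ℕ} (A : Matrix (Fin m) (Fin n) ℝ) (owner : Fin m → V) (p : V) :
    Matrix {i : Fin m // owner i = p} (Fin n) ℝ :=
  fun i j => A i.1 j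

/-- The block `b_p`: the entries of `b` held by node `p`. -/
def vecBlock {V : Type*} {m : ℕ} (b : Fin m → ℝ) (owner : Fin m → V) (p : V) :
    {i : Fin m // owner i = p} → ℝ :=
  fun i => b i.1

/-- The objective of the local problem at a node:
`(1/P) ‖z‖₁ + vᵀ z + (D ρ / 2) ‖z‖²`, with `P` the number of nodes and `D` the node's degree. -/
noncomputable def localObjective {n : ℕ} (P D : ℕ) (ρ : ℝ) (v z : Vec n) : ℝ :=
  (1 / (P : ℝ)) * l1Norm z + inner ℝ v z + ((D : ℝ) * ρ / 2) * ‖z‖ ^ 2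

/-- The sequences `x k p`, `γ k p` are produced by D-ADMM for a bipartite graph `G` with colour
classes `color = 0` and `color = 1`, penalty parameter `ρ`, and `A x = b` partitioned by rows among
the nodes. Iterations are counted from `0`. In each one, the nodes of colour `0` update first, from
the current estimates of their neighbours, then the nodes of colour `1`, from the new estimates of
theirs, and then all nodes update `γ`. -/
structure IsDADMMRun {V : Type*} [Fintype V] (G : SimpleGraph V) [DecidableRel G.Adj]
    (color : G.Coloring (Fin 2)) {m n : ℕ} (A : Matrix (Fin m) (Fin n) ℝ) (b : Fin m → ℝ)
    (owner : Fin m → V) (ρ : ℝ) (x γ : ℕ → V → Vec n) : Prop where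
  init_x : ∀ p, x 0 p = 0
  init_γ : ∀ p, γ 0 p = 0
  step_first : ∀ k p, color p = 0 →
    IsArgmin
      (localObjective (Fintype.card V) (G.degree p) ρ
        (γ k p - ρ • ∑ j ∈ G.neighborFinset p, x k j))
      (linearSolutions (rowBlock A owner p) (vecBlock b owner p))
      (x (k + 1) p)
  step_second : ∀ k p, color p = 1 →
    IsArgmin
      (localObjective (Fintype.card V) (G.degree p) ρ
        (γ k p - ρ • ∑ j ∈ G.neighborFinset p, x (k + 1) j))
      (linearSolutions (rowBlock A owner p) (vecBlock b owner p))
      (x (k + 1) p)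
  step_dual : ∀ k p,
    γ (k + 1) p = γ k p + ρ • ∑ j ∈ G.neighborFinset p, (x (k + 1) p - x (k + 1) j)

/-! D-ADMM is two-block ADMM in disguise. Give each edge a copy of the estimate at each of its ends,
require the two copies to agree, and attach a multiplier `λ_e` to this constraint. By bipartiteness,
the colour-`0` copies form one block and the colour-`1` copies the other, and each block splits into
independent problems at the nodes. The algorithm keeps only the net outflow `γ_p` of `λ` at each
node, which is all that the local problems need (`IsDADMMRun.gamma_eq_divergence`). The optimality
conditions of the local argmins then become the two ADMM inclusions (`IsDADMMRun.kkt_first`,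
`IsDADMMRun.kkt_second`).

ADMM itself converges for closed monotone relations that have a saddle point (`admm_tendsto`): a
weighted squared distance to any saddle point decreases, the residuals vanish, a cluster point is
again a saddle point, and the distance to that point must tend to `0`.

A saddle point comes from a Lagrange multiplier for BP, obtained by Hahn–Banach
(`IsBPSolution.exists_multiplier`). Its node contributions sum to zero, so connectedness makes them
the divergence of an edge flow (`exists_divergence_eq`). Conversely, summing the node conditions at
the limit cancels the multipliers and leaves optimality for BP. Full rank makes the constraints
feasible; connectedness with at least two nodes makes all degrees positive, so the local objectives
are strongly convex. -/

/-! ### Convergence of abstract ADMM -/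

/-- One step of ADMM for a pair of monotone relations: the distance to a saddle point decreases by
at least `ρ ‖u' - w‖`, all squared. -/
theorem admm_lyapunov_step {H : Type*} [NormedAddCommGroup H] [InnerProductSpace ℝ H]
    {ρ : ℝ} {l l' u' w w' ls xs : H} (hρ : 0 < ρ) (hl : l' = l + ρ • (u' - w'))
    (h1 : inner ℝ (l' + ρ • (w' - w) - ls) (u' - xs) ≤ 0)
    (h2 : 0 ≤ inner ℝ (l' - ls) (w' - xs)) :
    ‖l' - ls‖ ^ 2 + ρ ^ 2 * ‖w' - xs‖ ^ 2 + ρ ^ 2 * ‖u' - w‖ ^ 2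
      ≤ ‖l - ls‖ ^ 2 + ρ ^ 2 * ‖w - xs‖ ^ 2 := by
  obtain ⟨a, rfl⟩ : ∃ a, ls = l' - a := ⟨l' - ls, by abel⟩
  obtain ⟨c, rfl⟩ : ∃ c, xs = w' - c := ⟨w' - xs, by abel⟩
  obtain ⟨r, rfl⟩ : ∃ r, u' = w' + r := ⟨u' - w', by abel⟩
  obtain ⟨d, rfl⟩ : ∃ d, w = w' - d := ⟨w' - w, by abel⟩
  have e0 : l = l' - ρ • r := by rw [hl]; simp
  subst e0
  have e1 : l' - (l' - a) = a := by abel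
  have e2 : w' - (w' - c) = c := by abel
  have e3 : w' + r - (w' - d) = r + d := by abel
  have e4 : l' - ρ • r - (l' - a) = a - ρ • r := by abel
  have e5 : w' - d - (w' - c) = c - d := by abel
  have e6 : l' + ρ • (w' - (w' - d)) - (l' - a) = a + ρ • d := by
    rw [sub_sub_cancel]; abel
  have e7 : w' + r - (w' - c) = r + c := by abel
  rw [e6, e7] at h1
  rw [e1, e2] at h2
  rw [e1, e2, e3, e4, e5, norm_sub_sq_real, norm_sub_sq_real, norm_add_sq_real, norm_smul,
    mul_pow, Real.norm_eq_abs, sq_abs]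
  simp only [inner_add_left, inner_add_right, inner_smul_left, inner_smul_right,
    RCLike.conj_to_real] at h1 ⊢
  rw [real_inner_comm d c, real_inner_comm d r]
  -- Right side minus left side equals `2ρ⟪a, c⟫ - 2ρ⟪a + ρd, r + c⟫`.
  nlinarith [mul_nonneg hρ.le h2, mul_nonneg hρ.le (neg_nonneg.2 h1)]

/-- Convergence of ADMM for closed monotone relations in finite dimension, given a saddle point. -/
theorem admm_tendsto {H : Type*} [NormedAddCommGroup H] [InnerProductSpace ℝ H]
    [FiniteDimensional ℝ H] {ρ : ℝ} (hρ : 0 < ρ) {M₁ M₂ : Set (H × H)}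
    (hc₁ : IsClosed M₁) (hc₂ : IsClosed M₂)
    (hm₁ : ∀ a ∈ M₁, ∀ c ∈ M₁, inner ℝ (a.2 - c.2) (a.1 - c.1) ≤ 0)
    (hm₂ : ∀ a ∈ M₂, ∀ c ∈ M₂, 0 ≤ inner ℝ (a.2 - c.2) (a.1 - c.1))
    {s : H × H} (hs₁ : s ∈ M₁) (hs₂ : s ∈ M₂) {u w l : ℕ → H}
    (hu : ∀ k, (u (k + 1), l (k + 1) + ρ • (w (k + 1) - w k)) ∈ M₁)
    (hw : ∀ k, (w (k + 1), l (k + 1)) ∈ M₂)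
    (hl : ∀ k, l (k + 1) = l k + ρ • (u (k + 1) - w (k + 1))) :
    ∃ t : H × H, t ∈ M₁ ∧ t ∈ M₂ ∧ Tendsto u atTop (𝓝 t.1) ∧ Tendsto w atTop (𝓝 t.1) := by
  have : ProperSpace H := FiniteDimensional.proper ℝ H
  set E : H × H → ℕ → ℝ := fun t k => ‖l k - t.2‖ ^ 2 + ρ ^ 2 * ‖w k - t.1‖ ^ 2 with hE
  have step : ∀ t ∈ M₁, t ∈ M₂ → ∀ k, E t (k + 1) + ρ ^ 2 * ‖u (k + 1) - w k‖ ^ 2 ≤ E t k :=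
    fun t h1 h2 k => admm_lyapunov_step hρ (hl k) (hm₁ _ (hu k) _ h1) (hm₂ _ (hw k) _ h2)
  have E0 : ∀ t k, 0 ≤ E t k := fun t k => by positivity
  have anti : ∀ t ∈ M₁, t ∈ M₂ → Antitone (E t) := fun t h1 h2 =>
    antitone_nat_of_succ_le fun k => by
      have := step t h1 h2 k
      have : 0 ≤ ρ ^ 2 * ‖u (k + 1) - w k‖ ^ 2 := by positivity
      linarith
  have hlim : Tendsto (fun k => ‖u (k + 1) - w k‖ ^ 2) atTop (𝓝 0) := by
    have hE' : Tendsto (E s) atTop (𝓝 (⨅ k, E s k)) :=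
      tendsto_atTop_ciInf (anti s hs₁ hs₂) ⟨0, by rintro _ ⟨k, rfl⟩; exact E0 s k⟩
    have hd : Tendsto (fun k => (E s k - E s (k + 1)) / ρ ^ 2) atTop (𝓝 0) := by
      simpa using (hE'.sub (hE'.comp (tendsto_add_atTop_nat 1))).div_const (ρ ^ 2)
    refine squeeze_zero (fun k => by positivity) (fun k => ?_) hd
    rw [le_div_iff₀ (by positivity)]
    linarith [step s hs₁ hs₂ k]
  -- Monotonicity of `M₂` at successive iterates makes the cross term nonnegative, so the one
  -- vanishing quantity controls both residuals. Indices start at `1` because `(w 0, l 0)` need not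
  -- lie in `M₂`.
  have hmono : ∀ k, ‖u (k + 2) - w (k + 2)‖ ^ 2 + ‖w (k + 2) - w (k + 1)‖ ^ 2
      ≤ ‖u (k + 2) - w (k + 1)‖ ^ 2 := fun k => by
    have h := hm₂ _ (hw (k + 1)) _ (hw k)
    simp only [hl (k + 1), add_sub_cancel_left, inner_smul_left, RCLike.conj_to_real] at h
    have h := nonneg_of_mul_nonneg_right h hρ
    have e : u (k + 2) - w (k + 1) = (u (k + 2) - w (k + 2)) + (w (k + 2) - w (k + 1)) := by abel
    rw [e, norm_add_sq_real]
    linarith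
  have sq0 : ∀ f : ℕ → H, Tendsto (fun k => ‖f k‖ ^ 2) atTop (𝓝 0) → Tendsto f atTop (𝓝 0) :=
    fun f hf => by
      rw [tendsto_zero_iff_norm_tendsto_zero]
      simpa [Function.comp_def, Real.sqrt_sq] using (Real.continuous_sqrt.tendsto 0).comp hf
  have hlim' := (tendsto_add_atTop_iff_nat 1).2 hlim
  have hr : Tendsto (fun k => u k - w k) atTop (𝓝 0) :=
    (tendsto_add_atTop_iff_nat 2).1 <| sq0 _ <| squeeze_zero (fun k => by positivity)
      (fun k => by nlinarith [hmono k, sq_nonneg ‖w (k + 2) - w (k + 1)‖]) hlim'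
  have hd : Tendsto (fun k => w (k + 1) - w k) atTop (𝓝 0) :=
    (tendsto_add_atTop_iff_nat 1).1 <| sq0 _ <| squeeze_zero (fun k => by positivity)
      (fun k => by nlinarith [hmono k, sq_nonneg ‖u (k + 2) - w (k + 2)‖]) hlim'
  have hbdd : ∀ k, ((w (k + 1), l (k + 1)) : H × H) ∈
      Metric.closedBall s (max (√(E s 0) / ρ) √(E s 0)) := fun k => by
    have h0 : E s (k + 1) ≤ E s 0 := anti s hs₁ hs₂ (Nat.zero_le _)
    rw [Metric.mem_closedBall, Prod.dist_eq, dist_eq_norm, dist_eq_norm]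
    refine max_le_max ?_ ?_
    · rw [le_div_iff₀ hρ]
      apply Real.le_sqrt_of_sq_le
      have : 0 ≤ ‖l (k + 1) - s.2‖ ^ 2 := by positivity
      simp only [hE] at h0 ⊢
      linarith [mul_pow ‖w (k + 1) - s.1‖ ρ 2]
    · apply Real.le_sqrt_of_sq_le
      have : 0 ≤ ρ ^ 2 * ‖w (k + 1) - s.1‖ ^ 2 := by positivity
      simp only [hE] at h0 ⊢
      linarith
  obtain ⟨t, -, φ, hφ, ht⟩ := tendsto_subseq_of_bounded Metric.isBounded_closedBall hbdd
  have hφ' := hφ.tendsto_atTop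
  have hφ1 : Tendsto (fun k => φ k + 1) atTop atTop := (tendsto_add_atTop_nat 1).comp hφ'
  have tw : Tendsto (fun k => w (φ k + 1)) atTop (𝓝 t.1) :=
    (continuous_fst.tendsto t).comp ht
  have tl : Tendsto (fun k => l (φ k + 1)) atTop (𝓝 t.2) :=
    (continuous_snd.tendsto t).comp ht
  have tu : Tendsto (fun k => u (φ k + 1)) atTop (𝓝 t.1) := by
    simpa using (hr.comp hφ1).add tw
  have ht₂ : t ∈ M₂ := hc₂.mem_of_tendsto ht (Eventually.of_forall fun k => hw _)
  have ht₁ : t ∈ M₁ := by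
    have h2 : Tendsto (fun k => l (φ k + 1) + ρ • (w (φ k + 1) - w (φ k))) atTop (𝓝 t.2) := by
      simpa using tl.add ((hd.comp hφ').const_smul ρ)
    exact hc₁.mem_of_tendsto (tu.prodMk_nhds h2) (Eventually.of_forall fun k => hu _)
  -- The cluster point `t` is itself a saddle point, so `E t` is antitone, and its limit along a
  -- subsequence is its limit.
  have hEt : Tendsto (E t) atTop (𝓝 0) := by
    refine (tendsto_iff_tendsto_subseq_of_antitone (anti t ht₁ ht₂) hφ1).2 ?_
    have h1 := ((tl.sub_const t.2).norm.pow 2).add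
      (((tw.sub_const t.1).norm.pow 2).const_mul (ρ ^ 2))
    simpa [hE, Function.comp_def] using h1
  have tw' : Tendsto w atTop (𝓝 t.1) := by
    rw [← tendsto_sub_nhds_zero_iff]
    refine sq0 _ (squeeze_zero (fun k => by positivity) (fun k => ?_)
      (by simpa using hEt.div_const (ρ ^ 2)))
    rw [le_div_iff₀ (by positivity)]
    have : 0 ≤ ‖l k - t.2‖ ^ 2 := by positivity
    simp only [hE]
    linarith
  exact ⟨t, ht₁, ht₂, by simpa using hr.add tw', tw'⟩

/-! ### The `ℓ₁` norm -/

section L1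

variable {n : ℕ}

theorem l1Norm_nonneg (x : Vec n) : 0 ≤ l1Norm x :=
  Finset.sum_nonneg fun _ _ => abs_nonneg _

theorem l1Norm_add_le (x y : Vec n) : l1Norm (x + y) ≤ l1Norm x + l1Norm y := by
  simp only [l1Norm, ← Finset.sum_add_distrib]
  exact Finset.sum_le_sum fun i _ => abs_add_le _ _

theorem l1Norm_smul (c : ℝ) (x : Vec n) : l1Norm (c • x) = |c| * l1Norm x := by
  simp [l1Norm, Finset.mul_sum, abs_mul]

theorem continuous_l1Norm : Continuous (l1Norm : Vec n → ℝ) := by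
  unfold l1Norm
  fun_prop

theorem norm_le_l1Norm (x : Vec n) : ‖x‖ ≤ l1Norm x := by
  rw [EuclideanSpace.norm_eq]
  refine Real.sqrt_le_iff.2 ⟨l1Norm_nonneg x, ?_⟩
  simpa [l1Norm] using Finset.sum_sq_le_sq_sum_of_nonneg
    (s := Finset.univ) (f := fun i => |x i|) fun _ _ => abs_nonneg _

theorem convexOn_l1Norm : ConvexOn ℝ Set.univ (l1Norm : Vec n → ℝ) := by
  refine ⟨convex_univ, fun x _ y _ a b ha hb _ => (l1Norm_add_le _ _).trans ?_⟩
  simp [l1Norm_smul, abs_of_nonneg ha, abs_of_nonneg hb]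

theorem tendsto_l1Norm_cocompact : Tendsto (l1Norm : Vec n → ℝ) (cocompact _) atTop :=
  tendsto_atTop_mono norm_le_l1Norm (tendsto_norm_cocompact_atTop)

end L1

/-! ### Minimizers of convex plus quadratic functions -/

section Argmin

theorem exists_isArgmin {E : Type*} [TopologicalSpace E] {f : E → ℝ} {S : Set E}
    (hf : Continuous f) (hS : IsClosed S) (hne : S.Nonempty)
    (hlim : Tendsto f (cocompact E) atTop) : ∃ x, IsArgmin f S x := by
  obtain ⟨x₀, h₀⟩ := hne
  obtain ⟨x, hx, h⟩ := hf.continuousOn.exists_isMinOn' hS h₀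
    ((hlim.eventually_ge_atTop (f x₀)).filter_mono inf_le_left)
  exact ⟨x, hx, fun y hy => h hy⟩

/-- First-order optimality for the sum of a convex function and a quadratic. -/
theorem isArgmin_add_quadratic {E : Type*} [NormedAddCommGroup E] [InnerProductSpace ℝ E]
    {φ : E → ℝ} (hφ : ConvexOn ℝ Set.univ φ) {S : Set E} (hS : Convex ℝ S) {v x : E} {c : ℝ}
    (hx : IsArgmin (fun z => φ z + inner ℝ v z + c / 2 * ‖z‖ ^ 2) S x) {y : E} (hy : y ∈ S) :
    0 ≤ φ y - φ x + inner ℝ (v + c • x) (y - x) := by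
  -- Compare `x` with `x + t(y - x)`, bound `φ` there by convexity, and divide by `t`; the last term
  -- vanishes as `t → 0⁺`.
  have key : ∀ t ∈ Set.Ioo (0 : ℝ) 1,
      0 ≤ φ y - φ x + inner ℝ (v + c • x) (y - x) + t * (c / 2 * ‖y - x‖ ^ 2) := by
    rintro t ⟨h0, h1⟩
    have hz : (1 - t) • x + t • y = x + t • (y - x) := by
      rw [smul_sub, sub_smul, one_smul]; abel
    have hmem := hS hx.1 hy (sub_nonneg.2 h1.le) h0.le (by ring)
    have hcv := hφ.2 (Set.mem_univ x) (Set.mem_univ y) (sub_nonneg.2 h1.le) h0.le (by ring)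
    have hmin := hx.2 _ hmem
    simp only [hz, smul_eq_mul] at hmin hcv
    rw [norm_add_sq_real, norm_smul, mul_pow, Real.norm_eq_abs, sq_abs, inner_add_right,
      inner_smul_right, inner_smul_right] at hmin
    rw [inner_add_left, inner_smul_left, RCLike.conj_to_real]
    refine nonneg_of_mul_nonneg_right (a := t) ?_ h0
    nlinarith
  have hlim : Tendsto (fun t : ℝ => φ y - φ x + inner ℝ (v + c • x) (y - x)
      + t * (c / 2 * ‖y - x‖ ^ 2)) (𝓝[>] 0) (𝓝 (φ y - φ x + inner ℝ (v + c • x) (y - x))) := by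
    refine Tendsto.mono_left ?_ nhdsWithin_le_nhds
    exact (Continuous.tendsto' (by fun_prop) _ _ (by simp))
  exact ge_of_tendsto hlim (eventually_of_mem (Ioo_mem_nhdsGT one_pos) key)

/-- Test the optimality condition of each minimizer at the other and add: the `φ` terms cancel,
leaving `0 ≤ -c‖x - y‖²`. -/
theorem isArgmin_add_quadratic_unique {E : Type*} [NormedAddCommGroup E] [InnerProductSpace ℝ E]
    {φ : E → ℝ} (hφ : ConvexOn ℝ Set.univ φ) {S : Set E} (hS : Convex ℝ S) {v x y : E} {c : ℝ}
    (hc : 0 < c) (hx : IsArgmin (fun z => φ z + inner ℝ v z + c / 2 * ‖z‖ ^ 2) S x)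
    (hy : IsArgmin (fun z => φ z + inner ℝ v z + c / 2 * ‖z‖ ^ 2) S y) : x = y := by
  have h1 := isArgmin_add_quadratic hφ hS hx hy.1
  have h2 := isArgmin_add_quadratic hφ hS hy hx.1
  have e : inner ℝ (v + c • x) (y - x) + inner ℝ (v + c • y) (x - y) = -(c * ‖x - y‖ ^ 2) := by
    rw [← neg_sub x y, inner_neg_right, neg_add_eq_sub, ← inner_sub_left,
      add_sub_add_left_eq_sub, ← smul_sub, ← neg_sub x y, smul_neg, inner_neg_left,
      inner_smul_left, real_inner_self_eq_norm_sq, RCLike.conj_to_real]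
  have h3 : ‖x - y‖ ^ 2 ≤ 0 := nonpos_of_mul_nonpos_right (by linarith) hc
  simpa [sub_eq_zero] using le_antisymm h3 (by positivity)

end Argmin

/-! ### Linear constraints and multipliers for Basis Pursuit -/

section LinearSystem

variable {ι : Type*} {n : ℕ} (A : Matrix ι (Fin n) ℝ) (b : ι → ℝ)

theorem isClosed_linearSolutions : IsClosed (linearSolutions A b) := by
  refine isClosed_eq ?_ continuous_const
  exact (LinearMap.continuous_on_pi A.mulVecLin).comp (PiLp.continuous_ofLp 2 _)

theorem convex_linearSolutions : Convex ℝ (linearSolutions A b) := by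
  intro x hx y hy s t _ _ hst
  simp only [linearSolutions, Set.mem_ofPred_eq] at hx hy ⊢
  simp [Matrix.mulVec_add, Matrix.mulVec_smul, hx, hy, ← add_smul, hst]

theorem mem_linearSolutions_iff {x : Vec n} :
    x ∈ linearSolutions A b ↔ ∀ i, inner ℝ (WithLp.toLp 2 (A i)) x = b i := by
  simp only [linearSolutions, Set.mem_ofPred_eq, funext_iff, Matrix.mulVec, dotProduct,
    PiLp.inner_apply]
  simp [mul_comm]

theorem mem_linearSolutions_iff_rowBlock {V : Type*} {m : ℕ} (A : Matrix (Fin m) (Fin n) ℝ)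
    (b : Fin m → ℝ) (owner : Fin m → V) {x : Vec n} :
    x ∈ linearSolutions A b ↔
      ∀ p, x ∈ linearSolutions (rowBlock A owner p) (vecBlock b owner p) := by
  simp only [mem_linearSolutions_iff]
  exact ⟨fun h p i => h i.1, fun h i => h (owner i) ⟨i, rfl⟩⟩

theorem linearSolutions_nonempty {m : ℕ} (A : Matrix (Fin m) (Fin n) ℝ) (hA : A.rank = m)
    (b : Fin m → ℝ) : (linearSolutions A b).Nonempty := by
  have htop : LinearMap.range A.mulVecLin = ⊤ :=
    Submodule.eq_top_of_finrank_eq (by rw [← Matrix.rank, hA]; simp)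
  obtain ⟨y, hy⟩ := LinearMap.range_eq_top.1 htop b
  exact ⟨WithLp.toLp 2 y, hy⟩

theorem exists_isBPSolution {m : ℕ} (A : Matrix (Fin m) (Fin n) ℝ) (hA : A.rank = m)
    (b : Fin m → ℝ) : ∃ x, IsBPSolution A b x :=
  exists_isArgmin continuous_l1Norm (isClosed_linearSolutions A b)
    (linearSolutions_nonempty A hA b) tendsto_l1Norm_cocompact

/-- Lagrange multipliers for Basis Pursuit: a combination of the rows of `A` is a subgradient of
the `ℓ₁` norm at a solution. -/
theorem IsBPSolution.exists_multiplier {m : ℕ} {A : Matrix (Fin m) (Fin n) ℝ} {b : Fin m → ℝ}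
    {x : Vec n} (hx : IsBPSolution A b x) :
    ∃ μ : Fin m → ℝ, ∀ y : Vec n,
      l1Norm x + inner ℝ (∑ i, μ i • (WithLp.toLp 2 (A i) : Vec n)) (y - x) ≤ l1Norm y := by
  have hxA := (mem_linearSolutions_iff A b).1 hx.1
  let L : Fin m → Vec n →ₗ[ℝ] ℝ := fun i => (innerSL ℝ (WithLp.toLp 2 (A i) : Vec n)).toLinearMap
  have hL : ∀ i y, L i y = inner ℝ (WithLp.toLp 2 (A i) : Vec n) y := fun i y => rfl
  let K : Submodule ℝ (Vec n) := ⨅ i, LinearMap.ker (L i)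
  have hK : ∀ y, y ∈ K ↔ ∀ i, inner ℝ (WithLp.toLp 2 (A i) : Vec n) y = 0 := fun y => by
    simp [K, hL]
  by_cases hxK : x ∈ K
  -- Here `b = 0`, so `0` is feasible and `‖x‖₁ ≤ 0`.
  · refine ⟨0, fun y => ?_⟩
    have h0 : (0 : Vec n) ∈ linearSolutions A b := by
      rw [mem_linearSolutions_iff]
      intro i
      rw [inner_zero_right, ← hxA i, (hK x).1 hxK i]
    have := hx.2 0 h0
    simp only [Pi.zero_apply, zero_smul, Finset.sum_const_zero, inner_zero_left, add_zero]
    have h00 : l1Norm (0 : Vec n) = 0 := by simp [l1Norm]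
    linarith [l1Norm_nonneg y]
  -- Hahn–Banach applies to the functional that is `0` on `K` and `‖x‖₁` at `x`. It is dominated by
  -- the norm because `c⁻¹k + x` is feasible for `k ∈ K`, `c > 0`. The extension kills `K`, the
  -- common kernel of the rows, so it is a combination of rows.
  · let f₀ : Vec n →ₗ.[ℝ] ℝ := ⟨K, 0⟩
    let f := f₀.supSpanSingleton x (l1Norm x) hxK
    have hf : ∀ (k : Vec n) (hk : k ∈ K) (c : ℝ) (h : k + c • x ∈ f.domain),
        f ⟨k + c • x, h⟩ = c * l1Norm x := fun k hk c h =>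
      (f₀.supSpanSingleton_apply_mk x (l1Norm x) hxK k hk c).trans (by simp [f₀])
    have hdom : ∀ k ∈ K, ∀ c : ℝ, k + c • x ∈ f.domain := fun k hk c =>
      Submodule.add_mem_sup hk (Submodule.smul_mem _ _ (Submodule.mem_span_singleton_self x))
    obtain ⟨g, hgf, hg⟩ := exists_extension_of_le_sublinear f l1Norm
      (fun c hc y => by rw [l1Norm_smul, abs_of_pos hc]) l1Norm_add_le (by
        rintro ⟨z, hz⟩
        obtain ⟨k, hk, w, hw, rfl⟩ := Submodule.mem_sup.1 hz
        obtain ⟨c, rfl⟩ := Submodule.mem_span_singleton.1 hw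
        rw [hf k hk c]
        rcases le_or_gt c 0 with hc | hc
        · exact (mul_nonpos_of_nonpos_of_nonneg hc (l1Norm_nonneg x)).trans (l1Norm_nonneg _)
        · have hmem : c⁻¹ • k + x ∈ linearSolutions A b := by
            rw [mem_linearSolutions_iff]
            intro i
            rw [inner_add_right, inner_smul_right, (hK k).1 hk i, hxA i]
            simp
          have := mul_le_mul_of_nonneg_left (hx.2 _ hmem) hc.le
          rw [← abs_of_pos hc, ← l1Norm_smul, ← l1Norm_smul, abs_of_pos hc, smul_add, smul_smul,
            mul_inv_cancel₀ hc.ne', one_smul, l1Norm_smul, abs_of_pos hc] at this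
          exact this)
    have hgK : ∀ k ∈ K, g k = 0 := fun k hk => by
      have h := hgf ⟨k + (0 : ℝ) • x, hdom k hk 0⟩
      rw [hf k hk 0] at h
      simpa using h
    have hgx : g x = l1Norm x := by
      have h := hgf ⟨0 + (1 : ℝ) • x, hdom 0 K.zero_mem 1⟩
      rw [hf 0 K.zero_mem 1] at h
      simpa using h
    obtain ⟨μ, hμ⟩ := (Submodule.mem_span_range_iff_exists_fun ℝ).1
      (mem_span_of_iInf_ker_le_ker (L := L) (K := g) fun k hk => hgK k hk)
    refine ⟨μ, fun y => ?_⟩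
    have : inner ℝ (∑ i, μ i • (WithLp.toLp 2 (A i) : Vec n)) (y - x) = g (y - x) := by
      rw [← hμ, sum_inner, LinearMap.sum_apply]
      simp [hL, inner_smul_left]
    rw [this, map_sub, hgx]
    linarith [hg y]

end LinearSystem

/-! ### Well-posedness of the local problems -/

section LocalProblem

variable {n : ℕ}

theorem continuous_localObjective (P D : ℕ) (ρ : ℝ) (v : Vec n) :
    Continuous (localObjective P D ρ v) := by
  have := continuous_l1Norm (n := n)
  unfold localObjective
  fun_prop

theorem tendsto_localObjective_cocompact (P : ℕ) {D : ℕ} (hD : 0 < D) {ρ : ℝ} (hρ : 0 < ρ)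
    (v : Vec n) : Tendsto (localObjective P D ρ v) (cocompact _) atTop := by
  have hc : 0 < (D : ℝ) * ρ / 2 := by positivity
  have h1 : Tendsto (fun r : ℝ => r * ((D : ℝ) * ρ / 2 * r + -‖v‖)) atTop atTop :=
    tendsto_id.atTop_mul_atTop₀
      (tendsto_atTop_add_const_right _ _ (tendsto_id.const_mul_atTop hc))
  refine tendsto_atTop_mono (fun z => ?_) (h1.comp (tendsto_norm_cocompact_atTop (E := Vec n)))
  have h2 : 0 ≤ 1 / (P : ℝ) * l1Norm z := mul_nonneg (by positivity) (l1Norm_nonneg z)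
  have h3 := neg_le_of_abs_le (abs_real_inner_le_norm v z)
  simp only [localObjective, Function.comp]
  linarith [mul_comm ‖z‖ ‖v‖, sq ‖z‖]

theorem convexOn_smul_l1Norm (P : ℕ) :
    ConvexOn ℝ Set.univ (fun z : Vec n => 1 / (P : ℝ) * l1Norm z) :=
  convexOn_l1Norm.smul (by positivity)

theorem existsUnique_isArgmin_localObjective {ι : Type*} (P : ℕ) {D : ℕ} (hD : 0 < D) {ρ : ℝ}
    (hρ : 0 < ρ) (v : Vec n) (A : Matrix ι (Fin n) ℝ) (b : ι → ℝ)
    (hne : (linearSolutions A b).Nonempty) :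
    ∃! x, IsArgmin (localObjective P D ρ v) (linearSolutions A b) x := by
  obtain ⟨x, hx⟩ := exists_isArgmin (continuous_localObjective P D ρ v)
    (isClosed_linearSolutions A b) hne (tendsto_localObjective_cocompact P hD hρ v)
  exact ⟨x, hx, fun y hy => isArgmin_add_quadratic_unique (convexOn_smul_l1Norm P)
    (convex_linearSolutions A b) (c := D * ρ) (by positivity) hy hx⟩

end LocalProblem

/-! ### Optimality conditions in edge variables -/

section KKT

variable {ι V E : Type*} [Fintype ι] [DecidableEq V] [NormedAddCommGroup E] [InnerProductSpace ℝ E]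

/-- Pairs `(u, l)` of vectors indexed by edges, where edge `e` belongs to node `π e`, such that `u`
takes one value `x p ∈ S p` on the edges of each node `p`, and minus the sum of `l` over these edges
is a subgradient of `φ` plus the indicator of `S p` at `x p`. -/
def kktRelation (π : ι → V) (φ : E → ℝ) (S : V → Set E) :
    Set (PiLp 2 (fun _ : ι => E) × PiLp 2 (fun _ : ι => E)) :=
  {a | (∀ e e', π e = π e' → a.1 e = a.1 e') ∧ ∀ e, a.1 e ∈ S (π e) ∧ ∀ y ∈ S (π e),
    0 ≤ φ y - φ (a.1 e) + inner ℝ (∑ e' with π e' = π e, a.2 e') (y - a.1 e)}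

theorem isClosed_kktRelation (π : ι → V) {φ : E → ℝ} (hφ : Continuous φ) {S : V → Set E}
    (hS : ∀ p, IsClosed (S p)) : IsClosed (kktRelation π φ S) := by
  have h1 : ∀ e, Continuous
      fun a : PiLp 2 (fun _ : ι => E) × PiLp 2 (fun _ : ι => E) => a.1 e := fun e => by fun_prop
  have h2 : ∀ e, Continuous
      fun a : PiLp 2 (fun _ : ι => E) × PiLp 2 (fun _ : ι => E) => a.2 e := fun e => by fun_prop
  simp only [kktRelation, Set.ofPred_and, Set.ofPred_forall]
  refine IsClosed.inter ?_ ?_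
  · exact isClosed_iInter fun e => isClosed_iInter fun e' => isClosed_iInter fun _ =>
      isClosed_eq (h1 e) (h1 e')
  · refine isClosed_iInter fun e => ((hS _).preimage (h1 e)).inter ?_
    refine isClosed_iInter fun y => isClosed_iInter fun _ => isClosed_le continuous_const ?_
    exact (continuous_const.sub (hφ.comp (h1 e))).add
      ((continuous_finsetSum _ fun e' _ => h2 e').inner (continuous_const.sub (h1 e)))

/-- On the edges of one node the first components are constant, so the inner product collapses to
one involving the sums of multipliers. Testing each subgradient inequality at the other point gives
its sign. -/
theorem kktRelation_monotone (π : ι → V) (φ : E → ℝ) (S : V → Set E) :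
    ∀ a ∈ kktRelation π φ S, ∀ c ∈ kktRelation π φ S,
      inner ℝ (a.2 - c.2) (a.1 - c.1) ≤ 0 := by
  rintro a ⟨ha, ha'⟩ c ⟨hc, hc'⟩
  rw [PiLp.inner_apply, ← Finset.sum_fiberwise_of_maps_to
    (t := Finset.univ.image π) (g := π) fun e _ => Finset.mem_image_of_mem π (Finset.mem_univ e)]
  refine Finset.sum_nonpos fun p hp => ?_
  obtain ⟨e, -, rfl⟩ := Finset.mem_image.1 hp
  have hsum : ∑ e' with π e' = π e, inner ℝ ((a.2 - c.2) e') ((a.1 - c.1) e')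
      = inner ℝ (∑ e' with π e' = π e, a.2 e' - ∑ e' with π e' = π e, c.2 e') (a.1 e - c.1 e) := by
    rw [← Finset.sum_sub_distrib, sum_inner]
    refine Finset.sum_congr rfl fun e' he' => ?_
    have he := (Finset.mem_filter.1 he').2
    simp [ha _ _ he, hc _ _ he]
  rw [hsum]
  have h1 := (ha' e).2 _ (hc' e).1
  have h2 := (hc' e).2 _ (ha' e).1
  rw [inner_sub_left]
  rw [← neg_sub (a.1 e), inner_neg_right] at h1
  linarith

theorem inner_nonneg_of_neg_mem_kktRelation {π : ι → V} {φ : E → ℝ} {S : V → Set E}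
    {a c : PiLp 2 (fun _ : ι => E) × PiLp 2 (fun _ : ι => E)}
    (ha : (a.1, -a.2) ∈ kktRelation π φ S) (hc : (c.1, -c.2) ∈ kktRelation π φ S) :
    0 ≤ inner ℝ (a.2 - c.2) (a.1 - c.1) := by
  have h := kktRelation_monotone _ _ _ _ ha _ hc
  have e : -a.2 - -c.2 = -(a.2 - c.2) := by abel
  rw [e, inner_neg_left] at h
  linarith

/-- Convergence of ADMM for edge variables that are tied together at both ends of the edges. -/
theorem admm_kktRelation_tendsto [FiniteDimensional ℝ E] {π₁ π₂ : ι → V} {φ : E → ℝ}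
    {S : V → Set E} {ρ : ℝ} (hρ : 0 < ρ) (hφ : Continuous φ) (hS : ∀ p, IsClosed (S p))
    {t₀ l₀ : PiLp 2 (fun _ : ι => E)} (h₁ : (t₀, l₀) ∈ kktRelation π₁ φ S)
    (h₂ : (t₀, -l₀) ∈ kktRelation π₂ φ S) {u w l : ℕ → PiLp 2 (fun _ : ι => E)}
    (hu : ∀ k, (u (k + 1), l (k + 1) + ρ • (w (k + 1) - w k)) ∈ kktRelation π₁ φ S)
    (hw : ∀ k, (w (k + 1), -l (k + 1)) ∈ kktRelation π₂ φ S)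
    (hl : ∀ k, l (k + 1) = l k + ρ • (u (k + 1) - w (k + 1))) :
    ∃ t l : PiLp 2 (fun _ : ι => E), (t, l) ∈ kktRelation π₁ φ S ∧ (t, -l) ∈ kktRelation π₂ φ S ∧
      (∀ e, Tendsto (fun k => u k e) atTop (𝓝 (t e))) ∧
      ∀ e, Tendsto (fun k => w k e) atTop (𝓝 (t e)) := by
  have hc : Continuous fun a : PiLp 2 (fun _ : ι => E) × PiLp 2 (fun _ : ι => E) => (a.1, -a.2) :=
    continuous_fst.prodMk continuous_snd.neg
  obtain ⟨t, ht₁, ht₂, htu, htw⟩ := admm_tendsto hρ (isClosed_kktRelation π₁ hφ hS)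
    ((isClosed_kktRelation π₂ hφ hS).preimage hc) (kktRelation_monotone _ _ _)
    (fun a ha c hc => inner_nonneg_of_neg_mem_kktRelation (a := a) (c := c) ha hc)
    (s := (t₀, l₀)) h₁ h₂ hu hw hl
  exact ⟨t.1, t.2, ht₁, ht₂, fun e => ((PiLp.continuous_apply 2 _ e).tendsto _).comp htu,
    fun e => ((PiLp.continuous_apply 2 _ e).tendsto _).comp htw⟩

end KKT

/-! ### Flows on bipartite graphs -/

section Graph

variable {V : Type*} {G : SimpleGraph V} {E : Type*} [AddCommGroup E]

/-- The edges of a bipartite graph, directed from colour `0` to colour `1`. -/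
abbrev BipartiteEdge (G : SimpleGraph V) (color : G.Coloring (Fin 2)) : Type _ :=
  {e : V × V // color e.1 = 0 ∧ G.Adj e.1 e.2}

/-- The net flow out of a node. -/
def divergence [DecidableEq V] {ι : Type*} [Fintype ι] (s t : ι → V) (l : ι → E) (p : V) : E :=
  ∑ e with s e = p, l e - ∑ e with t e = p, l e

variable {color : G.Coloring (Fin 2)}

theorem BipartiteEdge.color_snd (e : BipartiteEdge G color) : color e.1.2 = 1 := by
  have h1 := color.valid e.2.2
  have h2 := e.2.1
  omega

theorem divergence_of_color_zero [DecidableEq V] [Fintype (BipartiteEdge G color)]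
    (l : BipartiteEdge G color → E) {p : V} (hp : color p = 0) :
    divergence (fun e => e.1.1) (fun e => e.1.2) l p = ∑ e with e.1.1 = p, l e := by
  rw [divergence, sub_eq_self]
  refine Finset.sum_eq_zero fun e he => ?_
  have h1 := (Finset.mem_filter.1 he).2
  have h2 := e.color_snd
  simp_all

theorem divergence_of_color_one [DecidableEq V] [Fintype (BipartiteEdge G color)]
    (l : BipartiteEdge G color → E) {p : V} (hp : color p = 1) :
    divergence (fun e => e.1.1) (fun e => e.1.2) l p = - ∑ e with e.1.2 = p, l e := by
  rw [divergence, sub_eq_neg_self]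
  refine Finset.sum_eq_zero fun e he => ?_
  have h1 := (Finset.mem_filter.1 he).2
  have h2 := e.2.1
  simp_all

theorem sum_divergence [Fintype V] [DecidableEq V] {ι : Type*} [Fintype ι] (s t : ι → V)
    (l : ι → E) : ∑ p, divergence s t l p = 0 := by
  simp only [divergence, Finset.sum_sub_distrib]
  rw [Finset.sum_fiberwise, Finset.sum_fiberwise, sub_self]

theorem sum_edges_fst [Fintype V] [DecidableRel G.Adj] [DecidableEq V] (f : V → E) {p : V}
    (hp : color p = 0) :
    ∑ e : BipartiteEdge G color with e.1.1 = p, f e.1.2 = ∑ j ∈ G.neighborFinset p, f j := by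
  refine Finset.sum_bij (fun e _ => e.1.2) ?_ ?_ ?_ fun _ _ => rfl
  · rintro e he
    rw [SimpleGraph.mem_neighborFinset, ← (Finset.mem_filter.1 he).2]
    exact e.2.2
  · rintro e he e' he' h
    exact Subtype.ext (Prod.ext
      ((Finset.mem_filter.1 he).2.trans (Finset.mem_filter.1 he').2.symm) h)
  · intro j hj
    exact ⟨⟨(p, j), hp, (G.mem_neighborFinset p j).1 hj⟩, by simp, rfl⟩

theorem sum_edges_snd [Fintype V] [DecidableRel G.Adj] [DecidableEq V] (f : V → E) {p : V}
    (hp : color p = 1) :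
    ∑ e : BipartiteEdge G color with e.1.2 = p, f e.1.1 = ∑ j ∈ G.neighborFinset p, f j := by
  refine Finset.sum_bij (fun e _ => e.1.1) ?_ ?_ ?_ fun _ _ => rfl
  · rintro e he
    rw [SimpleGraph.mem_neighborFinset, ← (Finset.mem_filter.1 he).2]
    exact e.2.2.symm
  · rintro e he e' he' h
    exact Subtype.ext (Prod.ext h
      ((Finset.mem_filter.1 he).2.trans (Finset.mem_filter.1 he').2.symm))
  · intro j hj
    have hadj := (G.mem_neighborFinset p j).1 hj
    have h := color.valid hadj
    exact ⟨⟨(j, p), show color j = 0 by omega, hadj.symm⟩, by simp, rfl⟩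

theorem divergence_add [DecidableEq V] {ι : Type*} [Fintype ι] (s t : ι → V) (l l' : ι → E) :
    divergence s t (l + l') = divergence s t l + divergence s t l' := by
  funext p
  simp only [divergence, Pi.add_apply, Finset.sum_add_distrib]
  abel

theorem divergence_neg [DecidableEq V] {ι : Type*} [Fintype ι] (s t : ι → V) (l : ι → E) :
    divergence s t (-l) = -divergence s t l := by
  funext p
  simp only [divergence, Pi.neg_apply, Finset.sum_neg_distrib]
  abel

theorem divergence_single [DecidableEq V] {ι : Type*} [Fintype ι] [DecidableEq ι] (s t : ι → V)
    (e : ι) (v : E) :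
    divergence s t (Pi.single e v) = Pi.single (s e) v - Pi.single (t e) v := by
  funext p
  simp only [divergence, Finset.sum_filter, Pi.sub_apply, Pi.single_apply]
  congr 1 <;> rw [Finset.sum_eq_single e] <;> simp +contextual [eq_comm]

/-- In a connected bipartite graph, every assignment of net outflows with sum zero is the divergence
of a flow. -/
theorem exists_divergence_eq [Fintype V] [DecidableEq V] [Fintype (BipartiteEdge G color)]
    (hG : G.Connected) (c : V → E) (hc : ∑ p, c p = 0) :
    ∃ l : BipartiteEdge G color → E, divergence (fun e => e.1.1) (fun e => e.1.2) l = c := by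
  classical
  -- The divergences form a subgroup. It contains transfers along edges, hence, telescoping along
  -- walks, transfers between any two nodes. Since `∑ c = 0`, `c` is a sum of transfers between each
  -- `p` and a fixed `p₀`.
  let R : AddSubgroup (V → E) :=
    { carrier := {c | ∃ l : BipartiteEdge G color → E,
        divergence (fun e => e.1.1) (fun e => e.1.2) l = c}
      add_mem' := by
        rintro _ _ ⟨l, rfl⟩ ⟨l', rfl⟩
        exact ⟨l + l', divergence_add _ _ l l'⟩
      zero_mem' := ⟨0, by funext p; simp [divergence]⟩
      neg_mem' := by
        rintro _ ⟨l, rfl⟩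
        exact ⟨-l, divergence_neg _ _ l⟩ }
  have hadj : ∀ p q, G.Adj p q → ∀ v : E, Pi.single p v - Pi.single q v ∈ R := by
    intro p q h v
    have hv := color.valid h
    by_cases hp : color p = 0
    · exact ⟨Pi.single ⟨(p, q), hp, h⟩ v, divergence_single _ _ _ _⟩
    · rw [← neg_sub]
      exact R.neg_mem ⟨Pi.single ⟨(q, p), show color q = 0 by omega, h.symm⟩ v, divergence_single _ _ _ _⟩
  have hwalk : ∀ p q, G.Walk p q → ∀ v : E, Pi.single p v - Pi.single q v ∈ R := by
    intro p q w v
    induction w with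
    | nil => simp [R.zero_mem]
    | cons h _ ih => simpa using R.add_mem (hadj _ _ h v) ih
  obtain ⟨p₀⟩ := hG.nonempty
  have hdec : c = ∑ p, (Pi.single p (c p) - Pi.single p₀ (c p)) := by
    rw [Finset.sum_sub_distrib, Finset.univ_sum_single, eq_comm, sub_eq_self]
    funext q
    by_cases hq : q = p₀ <;> simp [Finset.sum_apply, hq, hc]
  have : c ∈ R := by
    rw [hdec]
    exact R.sum_mem fun p _ => hwalk p p₀ (hG.preconnected p p₀).some (c p)
  exact this

end Graph

/-! ### Existence and uniqueness of the iterates -/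

section Run

variable {V : Type*} [Fintype V] {G : SimpleGraph V} [DecidableRel G.Adj]
  {color : G.Coloring (Fin 2)} {m n : ℕ} {A : Matrix (Fin m) (Fin n) ℝ} {b : Fin m → ℝ}
  {owner : Fin m → V} {ρ : ℝ}

theorem color_eq_zero_of_mem_neighborFinset {p j : V} (hp : color p = 1)
    (hj : j ∈ G.neighborFinset p) : color j = 0 := by
  have := color.valid ((G.mem_neighborFinset p j).1 hj)
  omega

theorem IsDADMMRun.unique
    (hU : ∀ p v, ∃! x, IsArgmin (localObjective (Fintype.card V) (G.degree p) ρ v)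
      (linearSolutions (rowBlock A owner p) (vecBlock b owner p)) x)
    {x γ x' γ' : ℕ → V → Vec n} (h : IsDADMMRun G color A b owner ρ x γ)
    (h' : IsDADMMRun G color A b owner ρ x' γ') : x = x' ∧ γ = γ' := by
  have key : ∀ k, x k = x' k ∧ γ k = γ' k := by
    intro k
    induction k with
    | zero => exact ⟨funext fun p => by rw [h.init_x, h'.init_x],
        funext fun p => by rw [h.init_γ, h'.init_γ]⟩
    | succ k ih =>
      obtain ⟨ihx, ihγ⟩ := ih
      have h0 : ∀ p, color p = 0 → x (k + 1) p = x' (k + 1) p := fun p hp => by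
        have h2 := h'.step_first k p hp
        rw [← ihx, ← ihγ] at h2
        exact (hU p _).unique (h.step_first k p hp) h2
      have hx : x (k + 1) = x' (k + 1) := by
        funext p
        by_cases hp : color p = 0
        · exact h0 p hp
        have hp : color p = 1 := by omega
        have h2 := h'.step_second k p hp
        rw [← ihγ, ← Finset.sum_congr rfl fun j hj =>
          h0 j (color_eq_zero_of_mem_neighborFinset hp hj)] at h2
        exact (hU p _).unique (h.step_second k p hp) h2
      exact ⟨hx, funext fun p => by rw [h.step_dual, h'.step_dual, hx, ihγ]⟩
  exact ⟨funext fun k => (key k).1, funext fun k => (key k).2⟩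

theorem exists_isDADMMRun
    (hE : ∀ p v, ∃ x, IsArgmin (localObjective (Fintype.card V) (G.degree p) ρ v)
      (linearSolutions (rowBlock A owner p) (vecBlock b owner p)) x) :
    ∃ x γ : ℕ → V → Vec n, IsDADMMRun G color A b owner ρ x γ := by
  choose f hf using hE
  -- The value `0` at colour `1` is never used: neighbours of a colour-`1` node have colour `0`.
  let first : (V → Vec n) × (V → Vec n) → V → Vec n := fun s p =>
    if color p = 0 then f p (s.2 p - ρ • ∑ j ∈ G.neighborFinset p, s.1 j) else 0
  let second : (V → Vec n) × (V → Vec n) → V → Vec n := fun s p =>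
    if color p = 0 then first s p else f p (s.2 p - ρ • ∑ j ∈ G.neighborFinset p, first s j)
  let next : (V → Vec n) × (V → Vec n) → (V → Vec n) × (V → Vec n) := fun s =>
    (second s, fun p => s.2 p + ρ • ∑ j ∈ G.neighborFinset p, (second s p - second s j))
  let run : ℕ → (V → Vec n) × (V → Vec n) := fun k => next^[k] 0
  have hrun : ∀ k, run (k + 1) = next (run k) := fun k => Function.iterate_succ_apply' _ _ _
  refine ⟨fun k => (run k).1, fun k => (run k).2, fun _ => rfl, fun _ => rfl, ?_, ?_, ?_⟩
  · intro k p hp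
    have : (run (k + 1)).1 p = f p ((run k).2 p - ρ • ∑ j ∈ G.neighborFinset p, (run k).1 j) := by
      simp only [hrun, next, second, first, if_pos hp]
    rw [this]
    exact hf p _
  · intro k p hp
    have hp0 : ¬ color p = 0 := by omega
    have h1 : ∀ j ∈ G.neighborFinset p, (run (k + 1)).1 j = first (run k) j := fun j hj => by
      simp only [hrun, next, second, if_pos (color_eq_zero_of_mem_neighborFinset hp hj)]
    have : (run (k + 1)).1 p = f p ((run k).2 p - ρ • ∑ j ∈ G.neighborFinset p,
        (run (k + 1)).1 j) := by
      rw [Finset.sum_congr rfl h1]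
      simp only [hrun, next, second, if_neg hp0]
    rw [this]
    exact hf p _
  · intro k p
    simp only [hrun, next]

end Run

/-! ### Saddle points and Basis Pursuit solutions -/

section Saddle

variable {V : Type*} [Fintype V] {G : SimpleGraph V}
  {color : G.Coloring (Fin 2)} {m n : ℕ} {A : Matrix (Fin m) (Fin n) ℝ} {b : Fin m → ℝ}

/-- Primal and dual solutions of the consensus form of Basis Pursuit on a bipartite graph. -/
theorem exists_kkt_saddle [DecidableEq V] [Nonempty V] [Fintype (BipartiteEdge G color)] (hG : G.Connected)
    (owner : Fin m → V)
    {x : Vec n} (hx : IsBPSolution A b x) :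
    ∃ l : PiLp 2 (fun _ : BipartiteEdge G color => Vec n),
      (WithLp.toLp 2 (fun _ => x), l) ∈ kktRelation (fun e : BipartiteEdge G color => e.1.1)
        (fun z => 1 / (Fintype.card V : ℝ) * l1Norm z)
        (fun p => linearSolutions (rowBlock A owner p) (vecBlock b owner p)) ∧
      (WithLp.toLp 2 (fun _ => x), -l) ∈ kktRelation (fun e : BipartiteEdge G color => e.1.2)
        (fun z => 1 / (Fintype.card V : ℝ) * l1Norm z)
        (fun p => linearSolutions (rowBlock A owner p) (vecBlock b owner p)) := by
  obtain ⟨μ, hμ⟩ := hx.exists_multiplier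
  have hP : (Fintype.card V : ℝ) ≠ 0 := by simp
  let a : Fin m → Vec n := fun i => WithLp.toLp 2 (A i)
  -- The first term is orthogonal to feasible directions at `p`. The second is `-1/P` times a
  -- subgradient of the `ℓ₁` norm at `x`, and subtracting it makes the total zero.
  let c : V → Vec n := fun p =>
    ∑ i with owner i = p, μ i • a i - (1 / (Fintype.card V : ℝ)) • ∑ i, μ i • a i
  have hc : ∑ p, c p = 0 := by
    simp only [c, Finset.sum_sub_distrib, Finset.sum_fiberwise, Finset.sum_const,
      Finset.card_univ, ← Nat.cast_smul_eq_nsmul ℝ, smul_smul, mul_one_div_cancel hP, one_smul,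
      sub_self]
  have hxS := (mem_linearSolutions_iff_rowBlock A b owner).1 hx.1
  have hkkt : ∀ p, ∀ y ∈ linearSolutions (rowBlock A owner p) (vecBlock b owner p),
      0 ≤ 1 / (Fintype.card V : ℝ) * l1Norm y - 1 / (Fintype.card V : ℝ) * l1Norm x
        + inner ℝ (c p) (y - x) := by
    intro p y hy
    have hy' := (mem_linearSolutions_iff _ _).1 hy
    have hx' := (mem_linearSolutions_iff _ _).1 (hxS p)
    have h0 : inner ℝ (∑ i with owner i = p, μ i • a i) (y - x) = 0 := by
      rw [sum_inner]
      refine Finset.sum_eq_zero fun i hi => ?_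
      have hi := (Finset.mem_filter.1 hi).2
      have e : inner ℝ (a i) (y - x) = 0 := by
        rw [inner_sub_right, sub_eq_zero]
        exact (hy' ⟨i, hi⟩).trans (hx' ⟨i, hi⟩).symm
      rw [inner_smul_left, e, mul_zero]
    rw [inner_sub_left, h0, inner_smul_left, RCLike.conj_to_real]
    have h1 := mul_le_mul_of_nonneg_left (hμ y)
      (by positivity : 0 ≤ 1 / (Fintype.card V : ℝ))
    simp only [a]
    linarith
  obtain ⟨l, hl⟩ := exists_divergence_eq (color := color) hG c hc
  refine ⟨WithLp.toLp 2 l, ⟨fun _ _ _ => rfl, fun e => ⟨hxS _, fun y hy => ?_⟩⟩,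
    ⟨fun _ _ _ => rfl, fun e => ⟨hxS _, fun y hy => ?_⟩⟩⟩
  · have h := hkkt _ y hy
    rw [← hl, divergence_of_color_zero l e.2.1] at h
    exact h
  · have h := hkkt _ y hy
    rw [← hl, divergence_of_color_one l e.color_snd, ← Finset.sum_neg_distrib] at h
    exact h

/-- A common point that satisfies the optimality conditions of all nodes solves Basis Pursuit. -/
theorem isBPSolution_of_kkt [Nonempty V] {owner : Fin m → V} {x : Vec n} {c : V → Vec n}
    (hxS : ∀ p, x ∈ linearSolutions (rowBlock A owner p) (vecBlock b owner p))
    (hc : ∑ p, c p = 0)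
    (hkkt : ∀ p, ∀ y ∈ linearSolutions (rowBlock A owner p) (vecBlock b owner p),
      0 ≤ 1 / (Fintype.card V : ℝ) * l1Norm y - 1 / (Fintype.card V : ℝ) * l1Norm x
        + inner ℝ (c p) (y - x)) : IsBPSolution A b x := by
  refine ⟨(mem_linearSolutions_iff_rowBlock A b owner).2 hxS, fun y hy => ?_⟩
  have hP : (Fintype.card V : ℝ) ≠ 0 := by simp
  have h := Finset.sum_nonneg fun p (_ : p ∈ Finset.univ) =>
    hkkt p y ((mem_linearSolutions_iff_rowBlock A b owner).1 hy p)
  rw [Finset.sum_add_distrib, ← sum_inner, hc, inner_zero_left, add_zero, Finset.sum_const,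
    Finset.card_univ, nsmul_eq_mul, ← mul_sub, ← mul_assoc, mul_one_div_cancel hP, one_mul] at h
  linarith

end Saddle

/-! ### D-ADMM as ADMM on the edges -/

section Convergence

variable {V : Type*} [Fintype V] {G : SimpleGraph V} [DecidableRel G.Adj]
  {color : G.Coloring (Fin 2)} {m n : ℕ} {A : Matrix (Fin m) (Fin n) ℝ} {b : Fin m → ℝ}
  {owner : Fin m → V} {ρ : ℝ} {x γ : ℕ → V → Vec n}

/-- The edge multipliers of a run of D-ADMM. -/
noncomputable def edgeMultiplier (color : G.Coloring (Fin 2)) (ρ : ℝ) (x : ℕ → V → Vec n) :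
    ℕ → BipartiteEdge G color → Vec n
  | 0 => 0
  | k + 1 => fun e => edgeMultiplier color ρ x k e + ρ • (x (k + 1) e.1.1 - x (k + 1) e.1.2)

/-- The dual step is the divergence of the edge update, and the zero start gives the base case. -/
theorem IsDADMMRun.gamma_eq_divergence [DecidableEq V] (h : IsDADMMRun G color A b owner ρ x γ)
    (k : ℕ) :
    γ k = divergence (fun e => e.1.1) (fun e => e.1.2) (edgeMultiplier color ρ x k) := by
  induction k with
  | zero => funext p; simp [h.init_γ, edgeMultiplier, divergence]
  | succ k ih =>
    funext p
    rw [h.step_dual, ih]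
    by_cases hp : color p = 0
    · rw [divergence_of_color_zero _ hp, divergence_of_color_zero _ hp]
      simp only [edgeMultiplier, Finset.sum_add_distrib, ← Finset.smul_sum]
      rw [← sum_edges_fst (fun j => x (k + 1) p - x (k + 1) j) hp]
      congr 2
      exact Finset.sum_congr rfl fun e he => by rw [(Finset.mem_filter.1 he).2]
    · have hp : color p = 1 := by omega
      rw [divergence_of_color_one _ hp, divergence_of_color_one _ hp]
      simp only [edgeMultiplier, Finset.sum_add_distrib, ← Finset.smul_sum]
      rw [← sum_edges_snd (fun j => x (k + 1) p - x (k + 1) j) hp, neg_add, ← smul_neg]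
      congr 2
      rw [← Finset.sum_neg_distrib]
      exact Finset.sum_congr rfl fun e he => by rw [(Finset.mem_filter.1 he).2, neg_sub]

/-- The colour-`0` update uses old neighbour values; rewriting it with the new multiplier `λ_e +
ρ(x_p - x_j)` leaves the correction `ρ(x_j^{new} - x_j^{old})` that ADMM allows in its first block.
-/
theorem IsDADMMRun.kkt_first [DecidableEq V] (h : IsDADMMRun G color A b owner ρ x γ) (k : ℕ)
    {p : V} (hp : color p = 0) {y : Vec n}
    (hy : y ∈ linearSolutions (rowBlock A owner p) (vecBlock b owner p)) :
    0 ≤ 1 / (Fintype.card V : ℝ) * l1Norm y - 1 / (Fintype.card V : ℝ) * l1Norm (x (k + 1) p)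
      + inner ℝ (∑ e : BipartiteEdge G color with e.1.1 = p, (edgeMultiplier color ρ x (k + 1) e
        + ρ • (x (k + 1) e.1.2 - x k e.1.2))) (y - x (k + 1) p) := by
  have h1 := isArgmin_add_quadratic (convexOn_smul_l1Norm (Fintype.card V))
    (convex_linearSolutions _ _) (h.step_first k p hp) hy
  convert h1 using 3
  rw [h.gamma_eq_divergence k, divergence_of_color_zero _ hp, ← sum_edges_fst (x k) hp]
  have h2 : ∑ e : BipartiteEdge G color with e.1.1 = p, x (k + 1) p = G.degree p • x (k + 1) p :=
    (sum_edges_fst (fun _ => x (k + 1) p) hp).trans (by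
      rw [Finset.sum_const, SimpleGraph.card_neighborFinset_eq_degree])
  rw [mul_comm, mul_smul, Nat.cast_smul_eq_nsmul, ← h2, Finset.smul_sum, Finset.smul_sum,
    ← Finset.sum_sub_distrib, ← Finset.sum_add_distrib]
  refine Finset.sum_congr rfl fun e he => ?_
  simp only [edgeMultiplier, (Finset.mem_filter.1 he).2, smul_sub]
  abel

/-- The colour-`1` update uses new neighbour values, so its gradient term `v + Dρx` is exactly the
next `γ_p`, with no correction. -/
theorem IsDADMMRun.kkt_second [DecidableEq V] (h : IsDADMMRun G color A b owner ρ x γ) (k : ℕ)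
    {p : V} (hp : color p = 1) {y : Vec n}
    (hy : y ∈ linearSolutions (rowBlock A owner p) (vecBlock b owner p)) :
    0 ≤ 1 / (Fintype.card V : ℝ) * l1Norm y - 1 / (Fintype.card V : ℝ) * l1Norm (x (k + 1) p)
      + inner ℝ (∑ e : BipartiteEdge G color with e.1.2 = p, -edgeMultiplier color ρ x (k + 1) e)
        (y - x (k + 1) p) := by
  have h1 := isArgmin_add_quadratic (convexOn_smul_l1Norm (Fintype.card V))
    (convex_linearSolutions _ _) (h.step_second k p hp) hy
  convert h1 using 3
  rw [Finset.sum_neg_distrib, ← divergence_of_color_one _ hp, ← h.gamma_eq_divergence,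
    h.step_dual, Finset.sum_sub_distrib, Finset.sum_const,
    SimpleGraph.card_neighborFinset_eq_degree, mul_comm, mul_smul, Nat.cast_smul_eq_nsmul, smul_sub]
  abel

/-- The edge values of a run of D-ADMM converge to a primal-dual solution. -/
theorem IsDADMMRun.tendsto_edges [DecidableEq V] [Nontrivial V] (hG : G.Connected)
    (hA : A.rank = m) (hρ : 0 < ρ) (h : IsDADMMRun G color A b owner ρ x γ) :
    ∃ t l : PiLp 2 (fun _ : BipartiteEdge G color => Vec n),
      (t, l) ∈ kktRelation (fun e : BipartiteEdge G color => e.1.1)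
        (fun z => 1 / (Fintype.card V : ℝ) * l1Norm z)
        (fun p => linearSolutions (rowBlock A owner p) (vecBlock b owner p)) ∧
      (t, -l) ∈ kktRelation (fun e : BipartiteEdge G color => e.1.2)
        (fun z => 1 / (Fintype.card V : ℝ) * l1Norm z)
        (fun p => linearSolutions (rowBlock A owner p) (vecBlock b owner p)) ∧
      (∀ e, Tendsto (fun k => x k e.1.1) atTop (𝓝 (t e))) ∧
      ∀ e, Tendsto (fun k => x k e.1.2) atTop (𝓝 (t e)) := by
  obtain ⟨x₀, hx₀⟩ := exists_isBPSolution A hA b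
  obtain ⟨l₀, h₁, h₂⟩ := exists_kkt_saddle (color := color) hG owner hx₀
  have hxS : ∀ k p,
      x (k + 1) p ∈ linearSolutions (rowBlock A owner p) (vecBlock b owner p) := fun k p => by
    by_cases hp : color p = 0
    · exact (h.step_first k p hp).1
    · exact (h.step_second k p (by omega)).1
  have hcont : Continuous fun z : Vec n => 1 / (Fintype.card V : ℝ) * l1Norm z :=
    continuous_const.mul continuous_l1Norm
  have hclosed : ∀ p, IsClosed (linearSolutions (rowBlock A owner p) (vecBlock b owner p)) :=
    fun p => isClosed_linearSolutions _ _
  have hu : ∀ k, (WithLp.toLp 2 (fun e : BipartiteEdge G color => x (k + 1) e.1.1),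
      WithLp.toLp 2 (edgeMultiplier color ρ x (k + 1)) + ρ •
        (WithLp.toLp 2 (fun e : BipartiteEdge G color => x (k + 1) e.1.2) -
          WithLp.toLp 2 (fun e : BipartiteEdge G color => x k e.1.2))) ∈
      kktRelation (fun e : BipartiteEdge G color => e.1.1)
        (fun z => 1 / (Fintype.card V : ℝ) * l1Norm z)
        (fun p => linearSolutions (rowBlock A owner p) (vecBlock b owner p)) := fun k =>
    ⟨fun e e' he => congrArg (x (k + 1)) he,
      fun e => ⟨hxS _ _, fun y hy => h.kkt_first k e.2.1 hy⟩⟩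
  have hw : ∀ k, (WithLp.toLp 2 (fun e : BipartiteEdge G color => x (k + 1) e.1.2),
      -WithLp.toLp 2 (edgeMultiplier color ρ x (k + 1))) ∈
      kktRelation (fun e : BipartiteEdge G color => e.1.2)
        (fun z => 1 / (Fintype.card V : ℝ) * l1Norm z)
        (fun p => linearSolutions (rowBlock A owner p) (vecBlock b owner p)) := fun k =>
    ⟨fun e e' he => congrArg (x (k + 1)) he,
      fun e => ⟨hxS _ _, fun y hy => h.kkt_second k e.color_snd hy⟩⟩
  have hl : ∀ k, WithLp.toLp 2 (edgeMultiplier color ρ x (k + 1)) =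
      WithLp.toLp 2 (edgeMultiplier color ρ x k) + ρ •
        (WithLp.toLp 2 (fun e : BipartiteEdge G color => x (k + 1) e.1.1) -
          WithLp.toLp 2 (fun e : BipartiteEdge G color => x (k + 1) e.1.2)) := fun k => rfl
  obtain ⟨t, l, ht₁, ht₂, htu, htw⟩ := admm_kktRelation_tendsto hρ hcont hclosed h₁ h₂
    (u := fun k => WithLp.toLp 2 fun e => x k e.1.1)
    (w := fun k => WithLp.toLp 2 fun e => x k e.1.2)
    (l := fun k => WithLp.toLp 2 (edgeMultiplier color ρ x k)) hu hw hl
  exact ⟨t, l, ht₁, ht₂, htu, htw⟩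

theorem IsDADMMRun.tendsto [Nontrivial V] (hG : G.Connected) (hA : A.rank = m) (hρ : 0 < ρ)
    (h : IsDADMMRun G color A b owner ρ x γ) :
    ∃ xs : Vec n, IsBPSolution A b xs ∧ ∀ p : V, Tendsto (fun k => x k p) atTop (𝓝 xs) := by
  classical
  obtain ⟨t, l, ht₁, ht₂, hfst, hsnd⟩ := h.tendsto_edges hG hA hρ
  have hedge : ∀ p q, G.Adj p q → ∃ e : BipartiteEdge G color,
      (e.1.1 = p ∧ e.1.2 = q) ∨ (e.1.1 = q ∧ e.1.2 = p) := fun p q hpq => by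
    have hv := color.valid hpq
    by_cases hp : color p = 0
    · exact ⟨⟨(p, q), hp, hpq⟩, .inl ⟨rfl, rfl⟩⟩
    · exact ⟨⟨(q, p), show color q = 0 by omega, hpq.symm⟩, .inr ⟨rfl, rfl⟩⟩
  -- Edge limits determine every node's limit only because no node is isolated.
  have hinc : ∀ p, ∃ e : BipartiteEdge G color, e.1.1 = p ∨ e.1.2 = p := fun p => by
    obtain ⟨q, hq⟩ := hG.preconnected.exists_adj_of_nontrivial p
    obtain ⟨e, he⟩ := hedge p q hq
    exact ⟨e, he.imp And.left And.right⟩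
  have hlim : ∀ p, ∃ z, Tendsto (fun k => x k p) atTop (𝓝 z) := fun p => by
    obtain ⟨e, rfl | rfl⟩ := hinc p
    exacts [⟨_, hfst e⟩, ⟨_, hsnd e⟩]
  choose z hz using hlim
  have hzadj : ∀ p q, G.Adj p q → z p = z q := fun p q hpq => by
    obtain ⟨e, ⟨rfl, rfl⟩ | ⟨rfl, rfl⟩⟩ := hedge p q hpq
    · exact (tendsto_nhds_unique (hz _) (hfst e)).trans (tendsto_nhds_unique (hsnd e) (hz _))
    · exact (tendsto_nhds_unique (hz _) (hsnd e)).trans (tendsto_nhds_unique (hfst e) (hz _))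
  obtain ⟨p₀⟩ := hG.nonempty
  have hzc : ∀ p, z p = z p₀ := fun p => by
    obtain ⟨W⟩ := hG.preconnected p p₀
    induction W with
    | nil => rfl
    | cons hadj _ ih => exact (hzadj _ _ hadj).trans ih
  have hx : ∀ p, Tendsto (fun k => x k p) atTop (𝓝 (z p₀)) := fun p => hzc p ▸ hz p
  have hte : ∀ e, t e = z p₀ := fun e => tendsto_nhds_unique (hfst e) (hx _)
  refine ⟨z p₀, ?_, hx⟩
  refine isBPSolution_of_kkt (owner := owner)
    ?_
    -- The node multipliers are the divergences of the limiting edge multiplier, whose total is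
    -- zero.
    (sum_divergence (fun e : BipartiteEdge G color => e.1.1) (fun e => e.1.2) l) ?_
  · intro p
    obtain ⟨e, rfl | rfl⟩ := hinc p
    · exact hte e ▸ (ht₁.2 e).1
    · exact hte e ▸ (ht₂.2 e).1
  intro p y hy
  obtain ⟨e, rfl | rfl⟩ := hinc p
  · rw [divergence_of_color_zero _ e.2.1, ← hte e]
    exact (ht₁.2 e).2 y hy
  · rw [divergence_of_color_one _ e.color_snd, ← hte e, ← Finset.sum_neg_distrib]
    exact (ht₂.2 e).2 y hy

end Convergence

theorem theorem1 {V : Type*} [Fintype V] [Nontrivial V] (G : SimpleGraph V) [DecidableRel G.Adj]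
    (hG : G.Connected) (color : G.Coloring (Fin 2))
    {m n : ℕ} (hmn : m < n) (A : Matrix (Fin m) (Fin n) ℝ) (hA : A.rank = m) (b : Fin m → ℝ)
    (owner : Fin m → V) (ρ : ℝ) (hρ : 0 < ρ) :
    (∃! s : (ℕ → V → Vec n) × (ℕ → V → Vec n), IsDADMMRun G color A b owner ρ s.1 s.2) ∧
    ∀ x γ : ℕ → V → Vec n, IsDADMMRun G color A b owner ρ x γ →
      ∃ xstar : Vec n, IsBPSolution A b xstar ∧
        ∀ p : V, Tendsto (fun k => x k p) atTop (𝓝 xstar) := by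
  have hU : ∀ p v, ∃! x, IsArgmin (localObjective (Fintype.card V) (G.degree p) ρ v)
      (linearSolutions (rowBlock A owner p) (vecBlock b owner p)) x := fun p v => by
    obtain ⟨y, hy⟩ := linearSolutions_nonempty A hA b
    exact existsUnique_isArgmin_localObjective _ (hG.preconnected.degree_pos_of_nontrivial p) hρ _
      _ _ ⟨y, (mem_linearSolutions_iff_rowBlock A b owner).1 hy p⟩
  obtain ⟨x, γ, h⟩ := exists_isDADMMRun (color := color) fun p v => (hU p v).exists
  refine ⟨⟨(x, γ), h, fun s hs => ?_⟩, fun x γ h => h.tendsto hG hA hρ⟩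
  obtain ⟨h1, h2⟩ := IsDADMMRun.unique hU hs h
  exact Prod.ext h1 h2
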